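/- An instance $\mathcal I=(F,C,d,f,B)$ of lower bounded facility location (LBFL) consists of finite sets $F$ (facilities) and $C$ (clients), a metric $d$ on $F\sqcup C$ in which distinct points may have distance $0$, opening costs $f_i\ge 0$ and lower bounds $B_i\in\mathbb Z_{\ge 0}$ for $i\in F$. For $\beta\in[0,1]$, a $\beta$-covered solution is a pair $(S,\sigma)$ with $S\subseteq F$, $\sigma\colon C\to S$ and $|\sigma^{-1}(i)|\ge\beta B_i$ for all $i\in S$; a solution is a $1$-covered solution. Put $\mathrm{ccost}_{\mathcal I}(\sigma)=\sum_{j\in C}d(j,\sigma_j)$ and $\mathrm{cost}_{\mathcal I}(S,\sigma)=\sum_{i\in S}f_i+\mathrm{ccost}_{\mathcal I}(\sigma)$. A solution is $\alpha$-approximate if its cost is at most $\alpha$ times the minimum cost of a solution. Let $\beta\in(1/2,1)$ and let $\mathcal I$ be an LBFL instance that has a solution. Call $(S^\circ,\sigma^\circ)$ a bi-criteria solution if it is $\beta$-covered, $\mathrm{cost}_{\mathcal I}(S^\circ,\sigma^\circ)\le\frac{2}{1-\beta}\,\mathrm{cost}_{\mathcal I}(S^*,\sigma^*)$ for an optimum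 solution $(S^*,\sigma^*)$ of $\mathcal I$, and $\sigma^\circ_j$ is a facility of $S^\circ$ nearest to $j$ for every $j\in C$. The client-aggregated instance is $\mathcal I^1=(F,C,d^1,f^1,B)$, where $d^1$ is obtained from $d$ by moving every client $j$ to the location of $\sigma^\circ_j$, that is, $d^1(i,i')=d(i,i')$, $d^1(i,j)=d(i,\sigma^\circ_j)$ and $d^1(j,j')=d(\sigma^\circ_j,\sigma^\circ_{j'})$ for $i,i'\in F$, $j,j'\in C$, and where $f^1_i=0$ for $i\in S^\circ$ and $f^1_i=f_i$ for $i\notin S^\circ$. Consider the following reduction to uncapacitated facility location (UFL). Discard the facilities with $B_i>|C|$. For every other $i$ let $J_i$ be a set of $B_i$ clients nearest to $i$, and let $f'_i=f_i+\frac{2\beta}{1-\beta}\sum_{j\in J_i}d(i,j)$. For a set $S$ of facilities to which all clients can be connected (that is, $S\neq\emptyset$ or $C=\emptyset$) let $\mathrm{cost}'(S)=\sum_{i\in S}f'_i+\sum_{j\in C}d(j,S)$, where $d(j,S)=\min_{i\in S}d(j,i)$. Take such a set $S'$ with $\mathrm{cost}'(S')\le\sum_{i\in T}f'_i+2\sum_{j\in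 C}d(j,T)$ for all such sets $T$; starting from $S'$, close single facilities as long as this is possible without increasing $\mathrm{cost}'$, keeping a set to which all clients can be connected; let $S^\circ$ be the resulting set, and let $\sigma^\circ$ connect every client to a nearest facility of $S^\circ$. Theorem. (i) The reduction has an output $(S^\circ,\sigma^\circ)$. (ii) Every output of the reduction is a bi-criteria solution. (iii) Let $(S^\circ,\sigma^\circ)$ be any bi-criteria solution, $\mathcal I^1$ the corresponding client-aggregated instance, and $\alpha_1\ge 0$. Then every $\alpha_1$-approximate solution $(S,\sigma)$ of $\mathcal I^1$ is itself (so, without further computation) an $\alpha$-approximate solution of $\mathcal I$, where $$\alpha=\alpha_1\left(1+\frac{2}{1-\beta}\right)+\frac{2}{1-\beta}.$$ -/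

import Mathlib

/-- An instance `(F, C, d, f, B)` of lower bounded facility location. The distance lives on the
disjoint union of facilities and clients, and distinct points may be at distance zero (a client and
a facility, or several clients, may share a location). -/
structure LBFLInstance (F C : Type*) where
  metric : PseudoMetricSpace (F ⊕ C)
  f : F → ℝ
  f_nonneg : ∀ i, 0 ≤ f i
  B : F → ℕ

/-- An instance `(F, C, d, f)` of uncapacitated facility location. -/
structure UFLInstance (F C : Type*) where
  metric : PseudoMetricSpace (F ⊕ C)
  f : F → ℝ
  f_nonneg : ∀ i, 0 ≤ f i

namespace UFLInstance

variable {F C : Type*} [Fintype C]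

/-- The distance between a client and a facility. -/
def d (U : UFLInstance F C) (j : C) (i : F) : ℝ := U.metric.dist (Sum.inr j) (Sum.inl i)

/-- `S` is a solution if all clients can be connected to facilities in `S`. -/
def IsSolution (_U : UFLInstance F C) (S : Finset F) : Prop := ∃ σ : C → F, ∀ j, σ j ∈ S

/-- The distance from a client to the nearest facility of `S`; only used for solutions `S`, where
the infimum is a minimum over a nonempty finite set. -/
noncomputable def distTo (U : UFLInstance F C) (j : C) (S : Finset F) : ℝ := ⨅ i : S, U.d j i

noncomputable def cost (U : UFLInstance F C) (S : Finset F) : ℝ :=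
  ∑ i ∈ S, U.f i + ∑ j, U.distTo j S

/-- One closing step: `T` arises from `S` by closing one facility, is still a solution, and is not
more expensive than `S`. -/
def ClosingStep [DecidableEq F] (U : UFLInstance F C) (S T : Finset F) : Prop :=
  ∃ i ∈ S, T = S.erase i ∧ U.IsSolution T ∧ U.cost T ≤ U.cost S

/-- `S` results from `S'` by performing closing steps until none is possible any more. -/
def IsClosingResult [DecidableEq F] (U : UFLInstance F C) (S' S : Finset F) : Prop :=
  Relation.ReflTransGen U.ClosingStep S' S ∧ ∀ T, ¬ U.ClosingStep S T

end UFLInstance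

namespace LBFLInstance

variable {F C : Type*} [Fintype C]

/-- The distance between a client and a facility. -/
def d (I : LBFLInstance F C) (j : C) (i : F) : ℝ := I.metric.dist (Sum.inr j) (Sum.inl i)

/-- The connection cost of `σ`. -/
noncomputable def ccost (I : LBFLInstance F C) (σ : C → F) : ℝ := ∑ j, I.d j (σ j)

noncomputable def cost (I : LBFLInstance F C) (S : Finset F) (σ : C → F) : ℝ :=
  ∑ i ∈ S, I.f i + I.ccost σ

/-- `(S, σ)` is a `β`-covered solution. -/
def IsCovered [DecidableEq F] (I : LBFLInstance F C) (β : ℝ) (S : Finset F) (σ : C → F) : Prop :=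
  (∀ j, σ j ∈ S) ∧
    ∀ i ∈ S, β * (I.B i : ℝ) ≤ ((Finset.univ.filter fun j => σ j = i).card : ℝ)

/-- A (valid) solution is a `1`-covered solution. -/
def IsSolution [DecidableEq F] (I : LBFLInstance F C) (S : Finset F) (σ : C → F) : Prop :=
  I.IsCovered 1 S σ

/-- `(S, σ)` is an `α`-approximate solution: a solution whose cost is at most `α` times the cost of
every solution, hence at most `α` times the optimum. -/
def IsApprox [DecidableEq F] (I : LBFLInstance F C) (α : ℝ) (S : Finset F) (σ : C → F) : Prop :=
  I.IsSolution S σ ∧ ∀ T τ, I.IsSolution T τ → I.cost S σ ≤ α * I.cost T τ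

/-- `σ` connects every client to a nearest facility of `S`. -/
def IsNearestAssignment (I : LBFLInstance F C) (S : Finset F) (σ : C → F) : Prop :=
  ∀ j, σ j ∈ S ∧ ∀ i ∈ S, I.d j (σ j) ≤ I.d j i

/-- A `β`-covered solution of cost at most `2 / (1 - β)` times the optimum (over `1`-covered
solutions) that connects every client to a nearest open facility. -/
def IsBicriteria [DecidableEq F] (I : LBFLInstance F C) (β : ℝ) (S : Finset F) (σ : C → F) : Prop :=
  I.IsCovered β S σ ∧
    (∀ T τ, I.IsSolution T τ → I.cost S σ ≤ 2 / (1 - β) * I.cost T τ) ∧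
    I.IsNearestAssignment S σ

/-- `J` is a set of `B i` clients nearest to `i`. -/
def IsNearestSet (I : LBFLInstance F C) (i : F) (J : Finset C) : Prop :=
  J.card = I.B i ∧ ∀ j ∈ J, ∀ j' ∉ J, I.d j i ≤ I.d j' i

/-- The auxiliary UFL instance, with opening costs
`f' i = f i + 2 β / (1 - β) * ∑ j ∈ J i, d (i, j)`. -/
noncomputable def toUFL (I : LBFLInstance F C) (β : ℝ) (hβ : β ∈ Set.Ioo (1 / 2 : ℝ) 1)
    (J : F → Finset C) : UFLInstance F C where
  metric := I.metric
  f i := I.f i + 2 * β / (1 - β) * ∑ j ∈ J i, I.d j i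
  f_nonneg i := by
    have h1 : 0 ≤ 2 * β / (1 - β) :=
      div_nonneg (by linarith [hβ.1]) (by linarith [hβ.2])
    have h2 : 0 ≤ ∑ j ∈ J i, I.d j i :=
      Finset.sum_nonneg fun j _ => @dist_nonneg _ I.metric (Sum.inr j) (Sum.inl i)
    exact add_nonneg (I.f_nonneg i) (mul_nonneg h1 h2)

/-- The facilities that can be open in some solution; a facility whose lower bound exceeds the
number of clients is discarded beforehand. -/
def usable [Fintype F] (I : LBFLInstance F C) : Finset F :=
  Finset.univ.filter fun i => I.B i ≤ Fintype.card C

/-- `(S, σ)` is an output of the reduction to UFL: start from a solution `S'` of the auxiliary UFL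
instance that costs at most `f'(T) + 2 ∑ j, d (j, T)` for every UFL solution `T`, close facilities
as long as this does not increase the cost, and connect every client to a nearest open facility. -/
def IsReductionOutput [Fintype F] [DecidableEq F] (I : LBFLInstance F C) (β : ℝ)
    (hβ : β ∈ Set.Ioo (1 / 2 : ℝ) 1) (S : Finset F) (σ : C → F) : Prop :=
  ∃ (J : F → Finset C) (S' : Finset F),
    (∀ i ∈ I.usable, I.IsNearestSet i (J i)) ∧
    S' ⊆ I.usable ∧ (I.toUFL β hβ J).IsSolution S' ∧
    (∀ T ⊆ I.usable, (I.toUFL β hβ J).IsSolution T →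
      (I.toUFL β hβ J).cost S' ≤
        ∑ i ∈ T, (I.toUFL β hβ J).f i + 2 * ∑ j, (I.toUFL β hβ J).distTo j T) ∧
    (I.toUFL β hβ J).IsClosingResult S' S ∧
    I.IsNearestAssignment S σ

/-- The new location of a point when every client `j` is moved to `σ₀ j`. -/
def moveTo (σ₀ : C → F) : F ⊕ C → F ⊕ C
  | Sum.inl i => Sum.inl i
  | Sum.inr j => Sum.inl (σ₀ j)

/-- The client-aggregated instance: every client `j` is moved to `σ₀ j`, and the facilities in `S₀`
become free. -/
def aggregate [DecidableEq F] (I : LBFLInstance F C) (S₀ : Finset F) (σ₀ : C → F) :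
    LBFLInstance F C where
  metric := @PseudoMetricSpace.induced (F ⊕ C) (F ⊕ C) (moveTo σ₀) I.metric
  f i := if i ∈ S₀ then 0 else I.f i
  f_nonneg i := by
    split_ifs
    · exact le_rfl
    · exact I.f_nonneg i
  B := I.B

end LBFLInstance

/-! The surcharge `f' i - f i` does two jobs. In a true solution each open facility `i` serves at
least `B i` clients, and the fibers are disjoint, so the surcharges total at most 2β/(1-β) times the
connection cost. Adding the factor 2 allowed on connections gives 2β/(1-β) + 2 = 2/(1-β)
(`IsSolution.toUFL_le`). Conversely, if an open `i` serves fewer than β `B i` clients, many clients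
of `J i` are served elsewhere, and the facility serving the nearest of them is so close to `i` that
the surcharge pays for rerouting all clients of `i` to it. So `i` could still be closed
(`card_fiber_ge_of_no_closingStep`).

Aggregation preserves feasibility, and each direction of the cost comparison loses at most the cost
of the bi-criteria solution, itself at most 2/(1-β) times the optimum. One loss is scaled by α₁, the
other is not (`isApprox_of_aggregate`). -/

namespace UFLInstance

variable {F C : Type*}

lemma d_nonneg (U : UFLInstance F C) (j : C) (i : F) : 0 ≤ U.d j i :=
  @dist_nonneg _ U.metric (Sum.inr j) (Sum.inl i)

lemma distTo_nonneg (U : UFLInstance F C) (j : C) (S : Finset F) : 0 ≤ U.distTo j S :=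
  Real.iInf_nonneg fun i => U.d_nonneg j i

lemma distTo_le (U : UFLInstance F C) (j : C) {S : Finset F} {i : F} (hi : i ∈ S) :
    U.distTo j S ≤ U.d j i :=
  ciInf_le (f := fun i : S => U.d j i)
    ⟨0, by rintro _ ⟨i, rfl⟩; exact U.d_nonneg j i⟩ ⟨i, hi⟩

lemma distTo_eq_of_nearest (U : UFLInstance F C) {j : C} {S : Finset F} {i : F} (hi : i ∈ S)
    (hmin : ∀ i' ∈ S, U.d j i ≤ U.d j i') : U.distTo j S = U.d j i := by
  have : Nonempty S := ⟨⟨i, hi⟩⟩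
  exact le_antisymm (U.distTo_le j hi) (le_ciInf fun i' => hmin i' i'.2)

variable [Fintype C]

lemma cost_le_of_assignment (U : UFLInstance F C) {S : Finset F} {σ : C → F}
    (hσ : ∀ j, σ j ∈ S) : U.cost S ≤ ∑ i ∈ S, U.f i + ∑ j, U.d j (σ j) := by
  unfold cost
  gcongr with j
  exact U.distTo_le j (hσ j)

lemma cost_eq_of_nearest (U : UFLInstance F C) {S : Finset F} {σ : C → F}
    (hσ : ∀ j, σ j ∈ S ∧ ∀ i ∈ S, U.d j (σ j) ≤ U.d j i) :
    U.cost S = ∑ i ∈ S, U.f i + ∑ j, U.d j (σ j) := by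
  unfold cost
  congr 1
  exact Finset.sum_congr rfl fun j _ => U.distTo_eq_of_nearest (hσ j).1 (hσ j).2

variable [DecidableEq F]

lemma exists_isClosingResult (U : UFLInstance F C) (S' : Finset F) :
    ∃ S, U.IsClosingResult S' S := by
  induction S' using Finset.strongInduction with
  | H S' ih =>
    by_cases h : ∃ T, U.ClosingStep S' T
    · obtain ⟨T, hT⟩ := h
      have hlt : T ⊂ S' := by
        obtain ⟨i, hi, rfl, -⟩ := hT
        exact Finset.erase_ssubset hi
      obtain ⟨S, hS, hend⟩ := ih T hlt
      exact ⟨S, .head hT hS, hend⟩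
    · exact ⟨S', .refl, fun T hT => h ⟨T, hT⟩⟩

/-- Closing facilities shrinks the set, preserves feasibility and does not increase the cost. -/
lemma closingSteps_invariant (U : UFLInstance F C) {S' S : Finset F}
    (h : Relation.ReflTransGen U.ClosingStep S' S) (hS' : U.IsSolution S') :
    S ⊆ S' ∧ U.IsSolution S ∧ U.cost S ≤ U.cost S' := by
  induction h with
  | refl => exact ⟨subset_rfl, hS', le_rfl⟩
  | tail _ hstep ih =>
    obtain ⟨i, -, rfl, hsol, hcost⟩ := hstep
    exact ⟨(Finset.erase_subset _ _).trans ih.1, hsol, hcost.trans ih.2.2⟩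

/-- Closing `i` and rerouting its clients to `i'` costs at most `d (i, i')` per client. -/
lemma cost_erase_le (U : UFLInstance F C) {S : Finset F} {σ : C → F}
    (hσ : ∀ j, σ j ∈ S ∧ ∀ i ∈ S, U.d j (σ j) ≤ U.d j i) {i i' : F} (hi : i ∈ S) (hi' : i' ∈ S)
    (hne : i' ≠ i) :
    U.cost (S.erase i) + U.f i ≤ U.cost S +
      (Finset.univ.filter fun j => σ j = i).card *
        U.metric.dist (Sum.inl i) (Sum.inl i') := by
  set D := U.metric.dist (Sum.inl i) (Sum.inl i')
  let τ : C → F := fun j => if σ j = i then i' else σ j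
  have hτ : ∀ j, τ j ∈ S.erase i := by
    intro j
    by_cases h : σ j = i
    · simp [τ, h, hne, hi']
    · simp [τ, h, (hσ j).1]
  have hle := U.cost_le_of_assignment hτ
  have hd : ∀ j, U.d j (τ j) ≤ U.d j (σ j) + if σ j = i then D else 0 := by
    intro j
    by_cases h : σ j = i
    · simp only [τ, h, if_true]
      exact @dist_triangle _ U.metric (Sum.inr j) (Sum.inl i) (Sum.inl i')
    · simp [τ, h]
  have hsum : ∑ j, U.d j (τ j) ≤
      ∑ j, U.d j (σ j) + (Finset.univ.filter fun j => σ j = i).card * D := by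
    refine (Finset.sum_le_sum fun j _ => hd j).trans_eq ?_
    rw [Finset.sum_add_distrib, ← Finset.sum_filter, Finset.sum_const, nsmul_eq_mul]
  rw [U.cost_eq_of_nearest hσ]
  linarith [Finset.sum_erase_add S U.f hi]

end UFLInstance

/-- A finite type has, for every `k` up to its cardinality, a set of `k` elements on which a given
function is smallest. -/
lemma Fintype.exists_card_eq_forall_le {C : Type*} [Fintype C] (g : C → ℝ) (k : ℕ)
    (hk : k ≤ Fintype.card C) :
    ∃ J : Finset C, J.card = k ∧ ∀ j ∈ J, ∀ j' ∉ J, g j ≤ g j' := by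
  classical
  induction k with
  | zero => exact ⟨∅, rfl, by simp⟩
  | succ k ih =>
    obtain ⟨J, hcard, hJ⟩ := ih (by omega)
    have hne : Jᶜ.Nonempty := by
      rw [← Finset.card_pos, Finset.card_compl]
      omega
    obtain ⟨a, ha, hmin⟩ := Jᶜ.exists_min_image g hne
    rw [Finset.mem_compl] at ha
    refine ⟨insert a J, by rw [Finset.card_insert_of_notMem ha, hcard], fun j hj y hout => ?_⟩
    rw [Finset.mem_insert, not_or] at hout
    rcases Finset.mem_insert.1 hj with rfl | hj
    · exact hmin y (Finset.mem_compl.2 hout.2)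
    · exact hJ j hj y hout.2

/-- A set whose elements are nearest minimizes the sum among all sets that are at least as large. -/
lemma Finset.sum_le_sum_of_card_le_of_forall_le {C : Type*} {g : C → ℝ} (hg : ∀ j, 0 ≤ g j)
    {J A : Finset C} (hJ : ∀ j ∈ J, ∀ j' ∉ J, g j ≤ g j') (hcard : J.card ≤ A.card) :
    ∑ j ∈ J, g j ≤ ∑ j ∈ A, g j := by
  classical
  have hc : (J \ A).card ≤ (A \ J).card := by
    have h1 := Finset.card_sdiff_add_card_inter J A
    have h2 := Finset.card_sdiff_add_card_inter A J
    rw [Finset.inter_comm] at h2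
    omega
  -- The largest value on `J \ A` is a threshold below every value on `A \ J`.
  have key : ∑ j ∈ J \ A, g j ≤ ∑ j ∈ A \ J, g j := by
    rcases (J \ A).eq_empty_or_nonempty with h | h
    · rw [h, Finset.sum_empty]
      exact Finset.sum_nonneg fun j _ => hg j
    · obtain ⟨a, ha, hmax⟩ := (J \ A).exists_max_image g h
      calc ∑ j ∈ J \ A, g j ≤ (J \ A).card • g a := Finset.sum_le_card_nsmul _ _ _ hmax
        _ ≤ (A \ J).card • g a := nsmul_le_nsmul_left (hg a) hc
        _ ≤ ∑ j ∈ A \ J, g j := Finset.card_nsmul_le_sum _ _ _ fun j hj =>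
            hJ a (Finset.mem_sdiff.1 ha).1 j (Finset.mem_sdiff.1 hj).2
  have h1 := Finset.sum_inter_add_sum_sdiff J A g
  have h2 := Finset.sum_inter_add_sum_sdiff A J g
  rw [Finset.inter_comm] at h2
  linarith

/-! ### Comparing lower bounded instances with their auxiliary UFL instances -/

namespace LBFLInstance

variable {F C : Type*}

lemma d_nonneg (I : LBFLInstance F C) (j : C) (i : F) : 0 ≤ I.d j i :=
  @dist_nonneg _ I.metric (Sum.inr j) (Sum.inl i)

lemma exists_isNearestAssignment (I : LBFLInstance F C) {S : Finset F} {τ : C → F}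
    (hτ : ∀ j, τ j ∈ S) : ∃ σ, I.IsNearestAssignment S σ := by
  choose σ hσ using fun j => S.exists_min_image (I.d j) ⟨τ j, hτ j⟩
  exact ⟨σ, hσ⟩

variable [Fintype C]

lemma cost_le_toUFL_cost (I : LBFLInstance F C) {β : ℝ} (hβ : β ∈ Set.Ioo (1 / 2 : ℝ) 1)
    (J : F → Finset C) {S : Finset F} {σ : C → F} (hσ : I.IsNearestAssignment S σ) :
    I.cost S σ ≤ (I.toUFL β hβ J).cost S := by
  rw [(I.toUFL β hβ J).cost_eq_of_nearest hσ]
  have hf : ∀ i, I.f i ≤ (I.toUFL β hβ J).f i := fun i =>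
    le_add_of_nonneg_right <| mul_nonneg
      (div_nonneg (by linarith [hβ.1]) (by linarith [hβ.2]))
      (Finset.sum_nonneg fun j _ => I.d_nonneg j i)
  exact add_le_add_left (Finset.sum_le_sum fun i _ => hf i) _

variable [DecidableEq F]

lemma IsSolution.B_le {I : LBFLInstance F C} {S : Finset F} {σ : C → F} (h : I.IsSolution S σ)
    {i : F} (hi : i ∈ S) : I.B i ≤ (Finset.univ.filter fun j => σ j = i).card := by
  have := h.2 i hi
  rw [one_mul] at this
  exact_mod_cast this

/-- The fiber of `i` has at least `B i` clients, so it is no cheaper than `J i`; the fibers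
partition the clients. -/
lemma IsSolution.sum_nearest_le_ccost {I : LBFLInstance F C} {S : Finset F} {σ : C → F}
    (h : I.IsSolution S σ) {J : F → Finset C} (hJ : ∀ i ∈ S, I.IsNearestSet i (J i)) :
    ∑ i ∈ S, ∑ j ∈ J i, I.d j i ≤ I.ccost σ := by
  calc ∑ i ∈ S, ∑ j ∈ J i, I.d j i
      ≤ ∑ i ∈ S, ∑ j ∈ Finset.univ.filter (fun j => σ j = i), I.d j i :=
        Finset.sum_le_sum fun i hi =>
          Finset.sum_le_sum_of_card_le_of_forall_le (fun j => I.d_nonneg j i) (hJ i hi).2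
            ((hJ i hi).1.trans_le (h.B_le hi))
    _ = ∑ i ∈ S, ∑ j ∈ Finset.univ.filter (fun j => σ j = i), I.d j (σ j) :=
        Finset.sum_congr rfl fun i _ => Finset.sum_congr rfl fun j hj => by
          rw [(Finset.mem_filter.1 hj).2]
    _ = I.ccost σ := Finset.sum_fiberwise_of_maps_to (fun j _ => h.1 j) _

lemma IsSolution.toUFL_le {I : LBFLInstance F C} {β : ℝ} (hβ : β ∈ Set.Ioo (1 / 2 : ℝ) 1)
    {S : Finset F} {σ : C → F} (h : I.IsSolution S σ) {J : F → Finset C}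
    (hJ : ∀ i ∈ S, I.IsNearestSet i (J i)) :
    ∑ i ∈ S, (I.toUFL β hβ J).f i + 2 * ∑ j, (I.toUFL β hβ J).distTo j S ≤
      2 / (1 - β) * I.cost S σ := by
  have hβ1 : 0 < 1 - β := by linarith [hβ.2]
  have hf : 0 ≤ ∑ i ∈ S, I.f i := Finset.sum_nonneg fun i _ => I.f_nonneg i
  have hone : 1 ≤ 2 / (1 - β) := by
    rw [le_div_iff₀ hβ1]
    linarith [hβ.1]
  have hsum : ∑ i ∈ S, (I.toUFL β hβ J).f i =
      ∑ i ∈ S, I.f i + 2 * β / (1 - β) * ∑ i ∈ S, ∑ j ∈ J i, I.d j i := by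
    rw [Finset.mul_sum, ← Finset.sum_add_distrib]
    rfl
  have hdist : ∑ j, (I.toUFL β hβ J).distTo j S ≤ I.ccost σ :=
    Finset.sum_le_sum fun j _ => (I.toUFL β hβ J).distTo_le j (h.1 j)
  have hnear := mul_le_mul_of_nonneg_left (h.sum_nearest_le_ccost hJ)
    (div_nonneg (by linarith [hβ.1]) hβ1.le : 0 ≤ 2 * β / (1 - β))
  have hsplit : 2 / (1 - β) * I.ccost σ = 2 * β / (1 - β) * I.ccost σ + 2 * I.ccost σ := by
    field_simp
    ring
  have hcost : 2 / (1 - β) * I.cost S σ =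
      2 / (1 - β) * ∑ i ∈ S, I.f i + 2 / (1 - β) * I.ccost σ := mul_add _ _ _
  linarith [mul_le_mul_of_nonneg_right hone hf]

/-- If no single facility can be closed without increasing the auxiliary cost, then every open
facility serves at least a `β` fraction of its lower bound. -/
lemma card_fiber_ge_of_no_closingStep (I : LBFLInstance F C) {β : ℝ}
    (hβ : β ∈ Set.Ioo (1 / 2 : ℝ) 1) {J : F → Finset C} {S : Finset F} {σ : C → F}
    (hσ : I.IsNearestAssignment S σ) (hend : ∀ T, ¬ (I.toUFL β hβ J).ClosingStep S T)
    {i : F} (hi : i ∈ S) (hJ : (J i).card = I.B i) :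
    β * (I.B i : ℝ) ≤ ((Finset.univ.filter fun j => σ j = i).card : ℝ) := by
  classical
  by_contra! hlt
  set A := Finset.univ.filter fun j => σ j = i with hA
  have hβ1 : 0 < 1 - β := by linarith [hβ.2]
  have hB0 : (0 : ℝ) ≤ I.B i := Nat.cast_nonneg _
  have hcard : (1 - β) * (I.B i : ℝ) < ((J i \ A).card : ℝ) := by
    have h : (J i).card ≤ (J i \ A).card + A.card := by
      have := Finset.le_card_sdiff A (J i)
      omega
    rw [hJ] at h
    have h' : (I.B i : ℝ) ≤ (J i \ A).card + A.card := by exact_mod_cast h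
    linarith
  have hne : (J i \ A).Nonempty := by
    rw [← Finset.card_pos]
    have : (0 : ℝ) < (J i \ A).card := (mul_nonneg hβ1.le hB0).trans_lt hcard
    exact_mod_cast this
  -- By averaging over more than (1-β) `B i` clients, this `j` is at distance at most 1/((1-β) `B
  -- i`) times the sum over `J i`.
  obtain ⟨j, hj, hmin⟩ := (J i \ A).exists_min_image (fun j => I.d j i) hne
  have hji : σ j ≠ i := by
    have := (Finset.mem_sdiff.1 hj).2
    simpa [hA] using this
  have hsum : (1 - β) * (I.B i : ℝ) * I.d j i ≤ ∑ j ∈ J i, I.d j i :=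
    calc (1 - β) * (I.B i : ℝ) * I.d j i ≤ (J i \ A).card * I.d j i :=
          mul_le_mul_of_nonneg_right hcard.le (I.d_nonneg j i)
      _ = (J i \ A).card • I.d j i := (nsmul_eq_mul _ _).symm
      _ ≤ ∑ j ∈ J i \ A, I.d j i := Finset.card_nsmul_le_sum _ _ _ hmin
      _ ≤ ∑ j ∈ J i, I.d j i := Finset.sum_le_sum_of_subset_of_nonneg Finset.sdiff_subset
          fun j _ _ => I.d_nonneg j i
  -- Since `j` prefers `σ j` to `i`, both legs of the detour through `j` are at most `d j i`.
  have hdist : I.metric.dist (Sum.inl i) (Sum.inl (σ j)) ≤ 2 * I.d j i := by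
    have h1 := @dist_triangle_left _ I.metric (Sum.inl i) (Sum.inl (σ j)) (Sum.inr j)
    have h2 := (hσ j).2 i hi
    unfold d at *
    linarith
  -- The coefficient 2β/(1-β) is chosen for this: fewer than β `B i` clients each move by at most `2
  -- * d j i`.
  have hreroute : (A.card : ℝ) * I.metric.dist (Sum.inl i) (Sum.inl (σ j)) ≤
      (I.toUFL β hβ J).f i :=
    calc (A.card : ℝ) * I.metric.dist (Sum.inl i) (Sum.inl (σ j))
        ≤ β * (I.B i : ℝ) * (2 * I.d j i) :=
          mul_le_mul hlt.le hdist (@dist_nonneg _ I.metric _ _)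
            (mul_nonneg (by linarith [hβ.1]) hB0)
      _ = 2 * β / (1 - β) * ((1 - β) * (I.B i : ℝ) * I.d j i) := by
          field_simp
      _ ≤ 2 * β / (1 - β) * ∑ j ∈ J i, I.d j i :=
          mul_le_mul_of_nonneg_left hsum (div_nonneg (by linarith [hβ.1]) hβ1.le)
      _ ≤ (I.toUFL β hβ J).f i := le_add_of_nonneg_left (I.f_nonneg i)
  have hclose : (I.toUFL β hβ J).cost (S.erase i) + (I.toUFL β hβ J).f i ≤
      (I.toUFL β hβ J).cost S + A.card * I.metric.dist (Sum.inl i) (Sum.inl (σ j)) :=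
    (I.toUFL β hβ J).cost_erase_le hσ hi (hσ j).1 hji
  exact hend _ ⟨i, hi, rfl, ⟨fun _ => σ j, fun _ => Finset.mem_erase.2 ⟨hji, (hσ j).1⟩⟩,
    by linarith⟩

/-! ### Transfer between the original and the aggregated instance -/

lemma aggregate_cost_le (I : LBFLInstance F C) (S₀ : Finset F) (σ₀ : C → F) (T : Finset F)
    (τ : C → F) :
    (I.aggregate S₀ σ₀).cost T τ ≤ I.cost T τ + I.ccost σ₀ := by
  have hf : ∑ i ∈ T, (I.aggregate S₀ σ₀).f i ≤ ∑ i ∈ T, I.f i :=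
    Finset.sum_le_sum fun i _ => by
      change (if i ∈ S₀ then 0 else I.f i) ≤ I.f i
      split_ifs
      exacts [I.f_nonneg i, le_rfl]
  have hd : (I.aggregate S₀ σ₀).ccost τ ≤ I.ccost σ₀ + I.ccost τ := by
    unfold ccost
    rw [← Finset.sum_add_distrib]
    exact Finset.sum_le_sum fun j _ =>
      @dist_triangle_left _ I.metric (Sum.inl (σ₀ j)) (Sum.inl (τ j)) (Sum.inr j)
  unfold cost
  linarith

/-- Facilities of `S` that became free lie in `S₀`, whose opening cost pays for them; each client
travels via `σ₀ j`. -/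
lemma cost_le_aggregate_cost (I : LBFLInstance F C) (S S₀ : Finset F) (σ σ₀ : C → F) :
    I.cost S σ ≤ (I.aggregate S₀ σ₀).cost S σ + I.cost S₀ σ₀ := by
  have hf : ∑ i ∈ S, I.f i ≤ ∑ i ∈ S, (I.aggregate S₀ σ₀).f i + ∑ i ∈ S₀, I.f i := by
    have hsplit : ∑ i ∈ S, I.f i =
        ∑ i ∈ S, (I.aggregate S₀ σ₀).f i + ∑ i ∈ S.filter (· ∈ S₀), I.f i := by
      rw [Finset.sum_filter, ← Finset.sum_add_distrib]
      refine Finset.sum_congr rfl fun i _ => ?_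
      change _ = (if i ∈ S₀ then 0 else I.f i) + _
      split_ifs <;> simp
    rw [hsplit]
    gcongr
    · exact fun i _ _ => I.f_nonneg i
    · exact fun i hi => (Finset.mem_filter.1 hi).2
  have hd : I.ccost σ ≤ I.ccost σ₀ + (I.aggregate S₀ σ₀).ccost σ := by
    unfold ccost
    rw [← Finset.sum_add_distrib]
    exact Finset.sum_le_sum fun j _ =>
      @dist_triangle _ I.metric (Sum.inr j) (Sum.inl (σ₀ j)) (Sum.inl (σ j))
  unfold cost at *
  linarith

lemma IsBicriteria.isApprox_of_aggregate {I : LBFLInstance F C} {β : ℝ} {S₀ : Finset F}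
    {σ₀ : C → F} (h₀ : I.IsBicriteria β S₀ σ₀) {α₁ : ℝ} (hα₁ : 0 ≤ α₁) {S : Finset F}
    {σ : C → F} (h : (I.aggregate S₀ σ₀).IsApprox α₁ S σ) :
    I.IsApprox (α₁ * (1 + 2 / (1 - β)) + 2 / (1 - β)) S σ := by
  -- Feasibility involves only the lower bounds, which aggregation keeps, so both instances have the
  -- same solutions.
  refine ⟨h.1, fun T τ hT => ?_⟩
  have h1 := I.cost_le_aggregate_cost S S₀ σ σ₀
  have h2 := h.2 T τ hT
  have h3 : I.cost S₀ σ₀ ≤ 2 / (1 - β) * I.cost T τ := h₀.2.1 T τ hT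
  have h4 : (I.aggregate S₀ σ₀).cost T τ ≤ I.cost T τ + I.ccost σ₀ :=
    I.aggregate_cost_le S₀ σ₀ T τ
  have h5 : I.ccost σ₀ ≤ I.cost S₀ σ₀ :=
    le_add_of_nonneg_left (Finset.sum_nonneg fun i _ => I.f_nonneg i)
  have h6 := mul_le_mul_of_nonneg_left
    (h4.trans (add_le_add_right (h5.trans h3) (I.cost T τ))) hα₁
  linarith

variable [Fintype F]

lemma IsSolution.subset_usable {I : LBFLInstance F C} {S : Finset F} {σ : C → F}
    (h : I.IsSolution S σ) : S ⊆ I.usable := fun _ hi =>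
  Finset.mem_filter.2 ⟨Finset.mem_univ _, (h.B_le hi).trans (Finset.card_le_univ _)⟩

lemma exists_isReductionOutput (I : LBFLInstance F C) {β : ℝ} (hβ : β ∈ Set.Ioo (1 / 2 : ℝ) 1)
    (hfeas : ∃ S σ, I.IsSolution S σ) : ∃ S₀ σ₀, I.IsReductionOutput β hβ S₀ σ₀ := by
  classical
  obtain ⟨R, ρ, hR⟩ := hfeas
  have hex : ∀ i, ∃ J : Finset C, i ∈ I.usable → I.IsNearestSet i J := fun i => by
    by_cases hi : i ∈ I.usable
    · obtain ⟨J, hJ⟩ := Fintype.exists_card_eq_forall_le (fun j => I.d j i) (I.B i)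
        (Finset.mem_filter.1 hi).2
      exact ⟨J, fun _ => hJ⟩
    -- The set chosen for a discarded facility is irrelevant.
    · exact ⟨∅, fun h => absurd h hi⟩
  choose J hJ using hex
  set U := I.toUFL β hβ J with hU
  -- An exact optimum meets the weaker bound with doubled connection cost, as distances are
  -- nonnegative.
  obtain ⟨S', hS', hmin⟩ := (I.usable.powerset.filter U.IsSolution).exists_min_image U.cost
    ⟨R, Finset.mem_filter.2 ⟨Finset.mem_powerset.2 hR.subset_usable, ρ, hR.1⟩⟩
  obtain ⟨hsub, hsol⟩ := Finset.mem_filter.1 hS'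
  obtain ⟨S, hS⟩ := U.exists_isClosingResult S'
  obtain ⟨τ, hτ⟩ := (U.closingSteps_invariant hS.1 hsol).2.1
  obtain ⟨σ, hσ⟩ := I.exists_isNearestAssignment hτ
  refine ⟨S, σ, J, S', hJ, Finset.mem_powerset.1 hsub, hsol, fun T hT hTsol => ?_, hS, hσ⟩
  have hle : U.cost S' ≤ ∑ i ∈ T, U.f i + ∑ j, U.distTo j T :=
    hmin T (Finset.mem_filter.2 ⟨Finset.mem_powerset.2 hT, hTsol⟩)
  have hnonneg : 0 ≤ ∑ j, U.distTo j T := Finset.sum_nonneg fun j _ => U.distTo_nonneg j T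
  linarith

lemma IsReductionOutput.isBicriteria {I : LBFLInstance F C} {β : ℝ}
    {hβ : β ∈ Set.Ioo (1 / 2 : ℝ) 1} {S : Finset F} {σ : C → F}
    (h : I.IsReductionOutput β hβ S σ) : I.IsBicriteria β S σ := by
  obtain ⟨J, S', hJ, hS', hsol, hbound, hclosing, hσ⟩ := h
  obtain ⟨hsub, -, hcost⟩ := (I.toUFL β hβ J).closingSteps_invariant hclosing.1 hsol
  refine ⟨⟨fun j => (hσ j).1, fun i hi => ?_⟩, fun T τ hT => ?_, hσ⟩
  · exact I.card_fiber_ge_of_no_closingStep hβ hσ hclosing.2 hi (hJ i (hS' (hsub hi))).1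
  · exact (I.cost_le_toUFL_cost hβ J hσ).trans <| hcost.trans <|
      (hbound T hT.subset_usable ⟨τ, hT.1⟩).trans <|
        hT.toUFL_le hβ fun i hi => hJ i (hT.subset_usable hi)

end LBFLInstance

/-- The conversion of solutions is the identity: the very pair `(S, σ)` that is `α₁`-approximate for
the aggregated instance is `α`-approximate for the original one, with no computation needed. -/
theorem mainTheorem5 {F C : Type*} [Fintype F] [DecidableEq F] [Fintype C]
    (I : LBFLInstance F C) (β : ℝ) (hβ : β ∈ Set.Ioo (1 / 2 : ℝ) 1)
    (hfeas : ∃ S σ, I.IsSolution S σ) :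
    (∃ S₀ σ₀, I.IsReductionOutput β hβ S₀ σ₀) ∧
    (∀ S₀ σ₀, I.IsReductionOutput β hβ S₀ σ₀ → I.IsBicriteria β S₀ σ₀) ∧
    (∀ S₀ σ₀, I.IsBicriteria β S₀ σ₀ →
      ∀ α₁ : ℝ, 0 ≤ α₁ → ∀ S σ, (I.aggregate S₀ σ₀).IsApprox α₁ S σ →
        I.IsApprox (α₁ * (1 + 2 / (1 - β)) + 2 / (1 - β)) S σ) := by
  exact ⟨I.exists_isReductionOutput hβ hfeas, fun _ _ h => h.isBicriteria,
    fun _ _ h₀ _ hα₁ _ _ h => h₀.isApprox_of_aggregate hα₁ h⟩
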